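/- Let $G$ be a finite group. Write $d(G)$ for the minimum number of generators of $G$ (so $d(G)=0$ if $G$ is trivial). For $x,y\in G$ write $x\equiv_{\mathrm m} y$ if $x$ and $y$ lie in exactly the same maximal subgroups of $G$. For a positive integer $r$ write $x\equiv_{\mathrm m}^{(r)}y$ if for all $z_1,\dots,z_{r-1}\in G$ we have $\langle x,z_1,\dots,z_{r-1}\rangle=G$ if and only if $\langle y,z_1,\dots,z_{r-1}\rangle=G$. Let $\psi(G)$ be the least positive integer $r$ such that the relations $\equiv_{\mathrm m}^{(r)}$ and $\equiv_{\mathrm m}$ on $G$ coincide; such an $r$ exists. Then: (1) $\psi(G)\ge d(G)$. Moreover, if $G$ has a normal subgroup $N$ which is not contained in the Frattini subgroup $\mathrm{Frat}(G)$ and satisfies $d(G/N)=d(G)$, then $\psi(G)\ge d(G)+1$. (2) If $G$ is soluble, then $\psi(G)\le d(G)+1$, and hence $\psi(G)\in\{d(G),d(G)+1\}$. -/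

import Mathlib

/-- `x ≡ₘ y`: the elements `x` and `y` lie in exactly the same maximal subgroups of `G`. -/
def equivM (G : Type*) [Group G] : Setoid G where
  r x y := ∀ M : Subgroup G, IsCoatom M → (x ∈ M ↔ y ∈ M)
  iseqv :=
    { refl := fun _ _ _ => Iff.rfl
      symm := fun h M hM => (h M hM).symm
      trans := fun h₁ h₂ M hM => (h₁ M hM).trans (h₂ M hM) }

/-- `x ≡ₘ⁽ʳ⁾ y`, for a positive integer `r`: for all `z₁, …, z_{r-1}` in `G`,
`⟨x, z₁, …, z_{r-1}⟩ = G` if and only if `⟨y, z₁, …, z_{r-1}⟩ = G`.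
(Only used for `0 < r`; the `zᵢ` need not be distinct.) -/
def equivMr (G : Type*) [Group G] (r : ℕ) : Setoid G where
  r x y := ∀ z : Fin (r - 1) → G,
    Subgroup.closure (insert x (Set.range z)) = ⊤ ↔
      Subgroup.closure (insert y (Set.range z)) = ⊤
  iseqv :=
    { refl := fun _ _ => Iff.rfl
      symm := fun h z => (h z).symm
      trans := fun h₁ h₂ z => (h₁ z).trans (h₂ z) }

/-- `ψ(G)`: the least positive integer `r` such that `≡ₘ⁽ʳ⁾` coincides with `≡ₘ`. -/
noncomputable def psi (G : Type*) [Group G] : ℕ :=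
  sInf {r : ℕ | 0 < r ∧ equivMr G r = equivM G}

theorem equivM_le_equivMr (G : Type*) [Group G] [Finite G] (r : ℕ) :
    equivM G ≤ equivMr G r := by
  have key : ∀ (x y : G), (∀ M : Subgroup G, IsCoatom M → (x ∈ M ↔ y ∈ M)) →
      ∀ s : Set G, Subgroup.closure (insert x s) = ⊤ → Subgroup.closure (insert y s) = ⊤ := by
    intro x y h s hx
    rcases eq_top_or_exists_le_coatom (Subgroup.closure (insert y s)) with h' | ⟨M, hM, hle⟩
    · exact h'
    · exfalso
      rw [Subgroup.closure_le, Set.insert_subset_iff] at hle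
      apply hM.1
      rw [eq_top_iff, ← hx, Subgroup.closure_le, Set.insert_subset_iff]
      exact ⟨(h M hM).2 hle.1, hle.2⟩
  intro x y h z
  exact ⟨key x y h _, key y x (fun M hM => (h M hM).symm) _⟩

/-- For a finite group the set in the definition of `psi` is nonempty, so that `psi G` really is
its least element. -/
theorem psi_isLeast (G : Type*) [Group G] [Finite G] :
    IsLeast {r : ℕ | 0 < r ∧ equivMr G r = equivM G} (psi G) := by
  classical
  have hne : {r : ℕ | 0 < r ∧ equivMr G r = equivM G}.Nonempty := by
    refine ⟨Nat.card G + 1, Nat.succ_pos _, le_antisymm ?_ (equivM_le_equivMr G _)⟩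
    have key : ∀ x y : G, (equivMr G (Nat.card G + 1)) x y →
        ∀ M : Subgroup G, IsCoatom M → y ∈ M → x ∈ M := by
      intro x y h M hM hy
      by_contra hx
      let z : Fin (Nat.card G + 1 - 1) → G := fun i =>
        if (Finite.equivFin G).symm i ∈ M then (Finite.equivFin G).symm i else 1
      have hz : Set.range z = (M : Set G) := by
        ext g
        constructor
        · rintro ⟨i, rfl⟩
          by_cases hi : (Finite.equivFin G).symm i ∈ M
          · simp [z, hi]
          · simp [z, hi, M.one_mem]
        · intro hg
          have hg' : g ∈ M := hg
          exact ⟨Finite.equivFin G g, by simp [z, hg']⟩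
      have hxt : Subgroup.closure (insert x (Set.range z)) = ⊤ := by
        rw [hz]
        refine hM.2 _ (lt_of_le_of_ne ?_ ?_)
        · exact fun g hg => Subgroup.subset_closure (Set.mem_insert_of_mem _ hg)
        · intro he
          exact hx (he ▸ Subgroup.subset_closure (Set.mem_insert _ _))
      have hyt := (h z).1 hxt
      rw [hz, Set.insert_eq_of_mem (show y ∈ (M : Set G) from hy), Subgroup.closure_eq] at hyt
      exact hM.1 hyt
    intro x y h M hM
    exact ⟨key y x ((equivMr G _).symm h) M hM, key x y h M hM⟩
  exact ⟨Nat.sInf_mem hne, fun _ hr => Nat.sInf_le hr⟩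

/-! Lower bounds: if `psi G` is so small that no `x` in a normal subgroup `N` extends to a
generating tuple of length `psi G`, then all of `N` is equivalent to 1, so `N` lies in every maximal
subgroup. Take `N = G` for the first bound.

Upper bound: in a soluble group of rank `d`, an element outside a maximal subgroup `M` generates `G`
together with some `d` elements of `M`, whereas an element of `M` does not. This is an induction
modulo an abelian minimal normal subgroup `V`. If `V ≤ M`, a relative Gaschütz lemma lifts
generators from `G ⧸ V` with corrections in `V`, hence inside `M`; otherwise `M` complements `V` and
is itself `d`-generated. -/

namespace Subgroup

variable {G : Type*} [Group G]

/-- A group of rank at most `d` is generated by a `d`-tuple. -/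
theorem exists_fin_closure_range_eq_top [Group.FG G] {d : ℕ} (hd : Group.rank G ≤ d) :
    ∃ g : Fin d → G, closure (Set.range g) = ⊤ := by
  classical
  obtain ⟨S, hS, hcl⟩ := Group.rank_spec G
  let e : S ≃ Fin S.card := S.equivFin
  refine ⟨fun i => if h : (i : ℕ) < S.card then (e.symm ⟨i, h⟩ : G) else 1, ?_⟩
  rw [eq_top_iff, ← hcl, closure_le]
  intro s hs
  refine subset_closure ⟨⟨e ⟨s, hs⟩, (e ⟨s, hs⟩).2.trans_le (hS.trans_le hd)⟩, ?_⟩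
  simp

/-- A group generated by the values of a `d`-tuple has rank at most `d`. -/
theorem rank_le_of_closure_range_eq_top [Group.FG G] {d : ℕ} {g : Fin d → G}
    (hg : closure (Set.range g) = ⊤) : Group.rank G ≤ d := by
  classical
  have h := Group.rank_le (G := G) (S := Finset.univ.image g) (by simpa using hg)
  exact h.trans (Finset.card_image_le.trans (by simp))

theorem rank_le_of_closure_insert_range_eq_top [Group.FG G] {d : ℕ} {x : G} {g : Fin d → G}
    (hg : closure (insert x (Set.range g)) = ⊤) : Group.rank G ≤ d + 1 := by
  refine rank_le_of_closure_range_eq_top (g := Fin.cons x g) ?_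
  rwa [Fin.range_cons]

/-- The intersection of an abelian normal subgroup with a supplement is normal. -/
theorem normal_inf_of_sup_eq_top {V K : Subgroup G} [V.Normal]
    (hab : ∀ a ∈ V, ∀ b ∈ V, a * b = b * a) (h : K ⊔ V = ⊤) : (K ⊓ V).Normal := by
  refine ⟨fun n hn g => ?_⟩
  have hg : g ∈ K ⊔ V := h ▸ mem_top g
  obtain ⟨k, hk, v, hv, rfl⟩ := mem_sup_of_normal_right.1 hg
  have hvn : v * n * v⁻¹ = n := by rw [hab v hv n hn.2, mul_inv_cancel_right]
  have : k * v * n * (k * v)⁻¹ = k * n * k⁻¹ := by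
    calc k * v * n * (k * v)⁻¹ = k * (v * n * v⁻¹) * k⁻¹ := by group
      _ = _ := by rw [hvn]
  rw [this]
  exact ⟨K.mul_mem (K.mul_mem hk hn.1) (K.inv_mem hk), ‹V.Normal›.conj_mem n hn.2 k⟩

/-- A supplement of an abelian minimal normal subgroup is either a complement or everything. -/
theorem inf_eq_bot_or_eq_top_of_sup_eq_top {V K : Subgroup G} [V.Normal]
    (hab : ∀ a ∈ V, ∀ b ∈ V, a * b = b * a)
    (hmin : ∀ W : Subgroup G, W.Normal → W ≤ V → W = ⊥ ∨ W = V) (h : K ⊔ V = ⊤) :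
    K ⊓ V = ⊥ ∨ K = ⊤ := by
  refine (hmin _ (normal_inf_of_sup_eq_top hab h) inf_le_right).imp_right fun hK => ?_
  rwa [sup_eq_left.2 (inf_eq_right.1 hK)] at h

/-- Dedekind's law: `K = L (K ⊓ V) = L`. -/
theorem eq_of_le_of_inf_eq_bot_of_sup_eq_top {V K L : Subgroup G} [V.Normal] (hLK : L ≤ K)
    (hK : K ⊓ V = ⊥) (hL : L ⊔ V = ⊤) : L = K := by
  refine le_antisymm hLK fun k hk => ?_
  have hk' : k ∈ L ⊔ V := hL ▸ mem_top k
  obtain ⟨l, hl, v, hv, rfl⟩ := mem_sup_of_normal_right.1 hk'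
  have hv1 : v ∈ K ⊓ V := ⟨by simpa using K.mul_mem (K.inv_mem (hLK hl)) hk, hv⟩
  rw [hK, mem_bot] at hv1
  simpa [hv1] using hl

theorem le_closure_mul_sup {ι : Type*} {V : Subgroup G} (s : Set G) (z : ι → G) (n : ι → V) :
    closure (s ∪ Set.range z) ≤ closure (s ∪ Set.range fun i => z i * n i) ⊔ V := by
  rw [closure_le]
  rintro _ (hx | ⟨i, rfl⟩)
  · exact mem_sup_left (subset_closure (Or.inl hx))
  · have h := mul_mem
      (mem_sup_left (T := V) (subset_closure (Or.inr ⟨i, rfl⟩) :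
        z i * n i ∈ closure (s ∪ Set.range fun i => z i * n i)))
      (mem_sup_right (V.inv_mem (n i).2))
    simpa using h

/-- A relative form of Gaschütz's lemma for an abelian minimal normal subgroup `V`: if a set `s`
and the tuple `z` generate `G` modulo `V`, and `G` is generated by some tuple of the same length
as `z`, then `z` can be modified by elements of `V` so as to generate `G` together with `s`. -/
theorem exists_closure_mul_eq_top [Finite G] {ι : Type*} [Finite ι] {V : Subgroup G} [V.Normal]
    (hab : ∀ a ∈ V, ∀ b ∈ V, a * b = b * a)
    (hmin : ∀ W : Subgroup G, W.Normal → W ≤ V → W = ⊥ ∨ W = V)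
    {g : ι → G} (hg : closure (Set.range g) = ⊤) (s : Set G) {z : ι → G}
    (hz : closure (s ∪ Set.range z) ⊔ V = ⊤) :
    ∃ n : ι → V, closure (s ∪ Set.range fun i => z i * n i) = ⊤ := by
  -- If every correction fails, each `K n` is a complement of `V`; the contradiction comes from
  -- counting these corrections.
  by_contra! hbad
  let K : (ι → V) → Subgroup G := fun n => closure (s ∪ Set.range fun i => z i * n i)
  have hKsup (n) : K n ⊔ V = ⊤ :=
    top_le_iff.1 (hz ▸ sup_le (le_closure_mul_sup s z n) le_sup_right)
  have hKinf (n) : K n ⊓ V = ⊥ :=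
    (inf_eq_bot_or_eq_top_of_sup_eq_top hab hmin (hKsup n)).resolve_right (hbad n)
  have hzK (n i) : z i * n i ∈ K n := subset_closure (Or.inr ⟨i, rfl⟩)
  -- `f n` moves the generators `g` into `K n` within their cosets of `V`.
  have hex (n : ι → V) (i : ι) : ∃ v : V, g i * v ∈ K n := by
    have hgi : g i ∈ K n ⊔ V := hKsup n ▸ mem_top _
    obtain ⟨k, hk, v, hv, h⟩ := mem_sup_of_normal_right.1 hgi
    exact ⟨⟨v⁻¹, V.inv_mem hv⟩, by simpa [← h] using hk⟩
  choose f hf using hex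
  have hKf (n) : closure (∅ ∪ Set.range fun i => g i * f n i) = K n := by
    refine eq_of_le_of_inf_eq_bot_of_sup_eq_top ?_ (hKinf n) ?_
    · rw [closure_le, Set.empty_union]
      rintro _ ⟨i, rfl⟩
      exact hf n i
    · refine top_le_iff.1 ((le_closure_mul_sup ∅ g (f n)).trans' ?_)
      rw [Set.empty_union, hg]
  -- `f n` determines `K n`, which determines `n`: a complement meets each coset of `V` only once.
  have hinj : Function.Injective f := by
    intro n m hnm
    have hK : K n = K m := by rw [← hKf n, ← hKf m, hnm]
    funext i
    have h1 : (z i * n i)⁻¹ * (z i * m i) ∈ K m := (K m).mul_mem ((K m).inv_mem (hK ▸ hzK n i)) (hzK m i)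
    have h2 : ((n i : G))⁻¹ * m i ∈ K m ⊓ V :=
      ⟨by simpa [mul_assoc] using h1, V.mul_mem (V.inv_mem (n i).2) (m i).2⟩
    rw [hKinf m, mem_bot, inv_mul_eq_one] at h2
    exact Subtype.ext h2
  -- An injective self-map of the finite set `ι → V` hits 1, so some `K n` contains every `g i`.
  obtain ⟨n, hn⟩ := Finite.surjective_of_injective hinj 1
  refine hbad n (top_le_iff.1 ?_)
  rw [← hg, closure_le]
  rintro _ ⟨i, rfl⟩
  simpa [hn] using hf n i

/-- A nontrivial finite soluble group has an abelian minimal normal subgroup. -/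
theorem exists_abelian_minimal_normal [Finite G] [Nontrivial G] [Group.IsSolvable G] :
    ∃ V : Subgroup G, V.Normal ∧ V ≠ ⊥ ∧ (∀ a ∈ V, ∀ b ∈ V, a * b = b * a) ∧
      ∀ W : Subgroup G, W.Normal → W ≤ V → W = ⊥ ∨ W = V := by
  obtain ⟨V, hV⟩ := (Set.toFinite {V : Subgroup G | V.Normal ∧ V ≠ ⊥}).exists_minimal
    ⟨⊤, inferInstance, top_ne_bot⟩
  have hmin : ∀ W : Subgroup G, W.Normal → W ≤ V → W = ⊥ ∨ W = V := fun W hW hle =>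
    or_iff_not_imp_left.2 fun hne => le_antisymm hle (hV.2 ⟨hW, hne⟩ hle)
  have := hV.1.1
  refine ⟨V, hV.1.1, hV.1.2, ?_, hmin⟩
  have hlt : ⁅V, V⁆ < V := Group.IsSolvable.commutator_lt_of_ne_bot hV.1.2
  have hbot := (hmin _ inferInstance hlt.le).resolve_right hlt.ne
  intro a ha b hb
  exact commutatorElement_eq_one_iff_mul_comm.1 (mem_bot.1 (hbot ▸ commutator_mem_commutator ha hb))

end Subgroup

open Subgroup in
/-- In a finite soluble group generated by `d` elements, an element outside a maximal subgroup `M`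
generates the group together with `d` suitable elements of `M`. -/
theorem exists_closure_insert_eq_top_of_notMem {d : ℕ} (m : ℕ) :
    ∀ (G : Type*) [Group G] [Finite G] [Group.IsSolvable G], Nat.card G ≤ m →
      Group.rank G ≤ d → ∀ M : Subgroup G, IsCoatom M → ∀ x ∉ M,
        ∃ z : Fin d → G, (∀ i, z i ∈ M) ∧ closure (insert x (Set.range z)) = ⊤ := by
  induction m with
  | zero => intro G _ _ _ hm; exact absurd hm (by simpa using Nat.card_pos.ne')
  | succ m ih =>
    intro G _ _ _ hm hd M hM x hx
    have : Nontrivial G := ⟨x, 1, fun h => hx (h ▸ M.one_mem)⟩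
    obtain ⟨V, hVn, hV, hab, hmin⟩ := exists_abelian_minimal_normal (G := G)
    have hrank : Group.rank (G ⧸ V) ≤ d :=
      (Group.rank_le_of_surjective (QuotientGroup.mk' V) (QuotientGroup.mk'_surjective V)).trans hd
    by_cases hVM : V ≤ M
    · have hker : (QuotientGroup.mk' V).ker ≤ M := by rwa [QuotientGroup.ker_mk']
      have hcm : (M.map (QuotientGroup.mk' V)).comap (QuotientGroup.mk' V) = M :=
        comap_map_eq_self hker
      have hmem (y : G) : QuotientGroup.mk' V y ∈ M.map (QuotientGroup.mk' V) ↔ y ∈ M := by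
        rw [← mem_comap, hcm]
      have hcard : Nat.card (G ⧸ V) ≤ m := by
        have h1 := card_eq_card_quotient_mul_card_subgroup V
        have h2 : 1 < Nat.card V := (one_lt_card_iff_ne_bot V).2 hV
        have h3 : 0 < Nat.card (G ⧸ V) := Nat.card_pos
        nlinarith
      have hco : IsCoatom (M.map (QuotientGroup.mk' V)) := by
        refine ⟨fun h => hx ((hmem x).1 (h ▸ mem_top _)), fun L hL => ?_⟩
        have hlt : M < L.comap (QuotientGroup.mk' V) := by
          rw [← hcm]
          exact (comap_lt_comap_of_surjective (QuotientGroup.mk'_surjective V)).2 hL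
        rw [← map_comap_eq_self_of_surjective (QuotientGroup.mk'_surjective V) L, hM.2 _ hlt,
          map_top_of_surjective _ (QuotientGroup.mk'_surjective V)]
      obtain ⟨w, hwM, hw⟩ := ih (G ⧸ V) hcard hrank _ hco (QuotientGroup.mk' V x)
        (fun h => hx ((hmem x).1 h))
      choose z hz using fun i => QuotientGroup.mk'_surjective V (w i)
      obtain rfl : (fun i => QuotientGroup.mk' V (z i)) = w := funext hz
      obtain ⟨g, hg⟩ := exists_fin_closure_range_eq_top hd
      have hsup : closure ({x} ∪ Set.range z) ⊔ V = ⊤ := by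
        have := comap_map_eq (QuotientGroup.mk' V) (closure ({x} ∪ Set.range z))
        rw [QuotientGroup.ker_mk'] at this
        rw [← this, MonoidHom.map_closure, Set.image_union, Set.image_singleton, ← Set.range_comp,
          Set.singleton_union]
        exact (congrArg (comap (QuotientGroup.mk' V)) hw).trans (comap_top _)
      obtain ⟨n, hn⟩ := exists_closure_mul_eq_top hab hmin hg {x} hsup
      exact ⟨fun i => z i * n i, fun i => M.mul_mem ((hmem _).1 (hwM i)) (hVM (n i).2),
        by rwa [Set.singleton_union] at hn⟩
    · have hsup : M ⊔ V = ⊤ := hM.2 _ (left_lt_sup.2 hVM)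
      have hinf : M ⊓ V = ⊥ :=
        (inf_eq_bot_or_eq_top_of_sup_eq_top hab hmin hsup).resolve_right hM.1
      obtain ⟨g, hg⟩ := exists_fin_closure_range_eq_top hd
      have hex (i : Fin d) : ∃ z ∈ M, ∃ v ∈ V, z * v = g i :=
        mem_sup_of_normal_right.1 (hsup ▸ mem_top _)
      choose z hzM v hv hzv using hex
      -- The `M`-components of generators of `G` generate `G` modulo `V`, hence the whole complement
      -- `M`.
      have hzcl : closure (Set.range z) = M := by
        refine eq_of_le_of_inf_eq_bot_of_sup_eq_top ?_ hinf (top_le_iff.1 ?_)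
        · rw [closure_le]
          rintro _ ⟨i, rfl⟩
          exact hzM i
        · rw [← hg, closure_le]
          rintro _ ⟨i, rfl⟩
          rw [← hzv i]
          exact mul_mem (mem_sup_left (subset_closure ⟨i, rfl⟩)) (mem_sup_right (hv i))
      refine ⟨z, hzM, hM.2 _ (lt_of_le_of_ne ?_ fun h => ?_)⟩
      · exact hzcl.ge.trans (closure_mono (Set.subset_insert _ _))
      · exact hx (h ▸ subset_closure (Set.mem_insert _ _))

/-- If `x` is equivalent to `1` under `≡ₘ`, then `x` lies in the Frattini subgroup. -/
theorem mem_frattini_of_equivM_one {G : Type*} [Group G] {x : G} (h : equivM G x 1) :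
    x ∈ frattini G := by
  simp only [frattini, Order.radical, Subgroup.mem_iInf]
  exact fun M hM => (h M hM).2 M.one_mem

theorem rank_le_psi (G : Type*) [Group G] [Finite G] : Group.rank G ≤ psi G := by
  obtain ⟨hpos, heq⟩ := (psi_isLeast G).1
  by_contra! hlt
  have hnot (x : G) (z : Fin (psi G - 1) → G) :
      Subgroup.closure (insert x (Set.range z)) ≠ ⊤ := fun h => by
    have := Subgroup.rank_le_of_closure_insert_range_eq_top h
    omega
  -- With no generating tuples of this length, both sides of the equivalence are always false.
  have htop : frattini G = ⊤ := by
    refine top_le_iff.1 fun x _ => mem_frattini_of_equivM_one ?_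
    rw [← heq]
    exact fun z => iff_of_false (hnot x z) (hnot 1 z)
  have hbot : (⊤ : Subgroup G) = ⊥ := by
    rcases eq_top_or_exists_le_coatom (⊥ : Subgroup G) with h | ⟨M, hM, -⟩
    · exact h.symm
    · exact absurd (top_le_iff.1 (htop ▸ frattini_le_coatom hM)) hM.1
  have hrank : Group.rank G ≤ 0 :=
    Subgroup.rank_le_of_closure_range_eq_top (g := Fin.elim0) (by simp [hbot])
  omega

/-- An element of `N` dies in `G ⧸ N`, so it would leave only `psi G - 1` generators for a quotient
of full rank. -/
theorem rank_add_one_le_psi {G : Type*} [Group G] [Finite G] (N : Subgroup G) [N.Normal]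
    (hN : ¬ N ≤ frattini G) (hrank : Group.rank (G ⧸ N) = Group.rank G) :
    Group.rank G + 1 ≤ psi G := by
  obtain ⟨hpos, heq⟩ := (psi_isLeast G).1
  by_contra! hlt
  have hnot (x : G) (hx : x ∈ N) (z : Fin (psi G - 1) → G) :
      Subgroup.closure (insert x (Set.range z)) ≠ ⊤ := fun h => by
    have h' := congrArg (Subgroup.map (QuotientGroup.mk' N)) h
    rw [MonoidHom.map_closure, Set.image_insert_eq, ← Set.range_comp,
      Subgroup.map_top_of_surjective _ (QuotientGroup.mk'_surjective N),
      show QuotientGroup.mk' N x = 1 from (QuotientGroup.eq_one_iff x).2 hx,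
      Subgroup.closure_insert_one] at h'
    have := Subgroup.rank_le_of_closure_range_eq_top h'
    omega
  refine hN fun x hx => mem_frattini_of_equivM_one ?_
  rw [← heq]
  exact fun z => iff_of_false (hnot x hx z) (hnot 1 N.one_mem z)

/-- If `M` separates `x` from `y`, a tuple inside `M` separates them too; its length is the rank,
and the element itself accounts for the extra 1. -/
theorem psi_le_rank_add_one (G : Type*) [Group G] [Finite G] [Group.IsSolvable G] :
    psi G ≤ Group.rank G + 1 := by
  refine (psi_isLeast G).2 ⟨Nat.succ_pos _, le_antisymm ?_ (equivM_le_equivMr G _)⟩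
  have key (x y : G) (h : equivMr G (Group.rank G + 1) x y) (M : Subgroup G) (hM : IsCoatom M)
      (hy : y ∈ M) : x ∈ M := by
    by_contra hx
    obtain ⟨z, hzM, hz⟩ :=
      exists_closure_insert_eq_top_of_notMem (Nat.card G) G le_rfl le_rfl M hM x hx
    refine hM.1 (top_le_iff.1 ?_)
    rw [← (h z).1 hz, Subgroup.closure_le, Set.insert_subset_iff]
    exact ⟨hy, Set.range_subset_iff.2 hzM⟩
  intro x y h M hM
  exact ⟨key y x ((equivMr G _).symm h) M hM, key x y h M hM⟩

theorem mainTheorem1 (G : Type*) [Group G] [Finite G] :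
    (Group.rank G ≤ psi G ∧
      ∀ (N : Subgroup G) [N.Normal], ¬ N ≤ frattini G →
        Group.rank (G ⧸ N) = Group.rank G → Group.rank G + 1 ≤ psi G) ∧
    (Group.IsSolvable G →
      psi G ≤ Group.rank G + 1 ∧
      psi G ∈ ({Group.rank G, Group.rank G + 1} : Set ℕ)) := by
  refine ⟨⟨rank_le_psi G, fun N _ => rank_add_one_le_psi N⟩, fun _ => ?_⟩
  have h1 := rank_le_psi G
  have h2 := psi_le_rank_add_one G
  refine ⟨h2, ?_⟩
  rw [Set.mem_insert_iff, Set.mem_singleton_iff]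
  omega
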